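/- Let $\mathbb{F}_q\subseteq\mathbb{F}_{q^n}$ be finite fields and let $V=\mathrm{End}_{\mathbb{F}_q}(\mathbb{F}_{q^n})$, an $n$-dimensional $\mathbb{F}_{q^n}$-space via $(cf)(x)=c\,f(x)$, whose elements are written uniquely as linearised polynomials $f(x)=\sum_{i=0}^{n-1}f_ix^{q^i}$. For an $\mathbb{F}_{q^n}$-subspace $\mathcal{C}$ of $V$ let $\mathcal{C}^\perp=\{g\in V:\sum_{i=0}^{n-1}f_ig_i=0\ \forall f\in\mathcal{C}\}$. For an $\mathbb{F}_q$-subspace $U$ of $\mathbb{F}_{q^n}^k$, the linear set $L(U)$ in $\mathrm{PG}(k-1,q^n)$ is the set of points $\langle u\rangle_{\mathbb{F}_{q^n}}$, $0\ne u\in U$, considered together with $U$; its rank is $\dim_{\mathbb{F}_q}U$, and the weight of a hyperplane $\mathrm{PG}(W)$ (where $W\le\mathbb{F}_{q^n}^k$ is an $\mathbb{F}_{q^n}$-subspace of dimension $k-1$) is $\dim_{\mathbb{F}_q}(U\cap W)$. The weight distribution of $L(U)$ with respect to hyperplanes is the vector $w(L(U))=(v_1,\dots,v_n)$, where $v_i$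 is the number of hyperplanes of weight $i$. For $\mathcal{C}$ of dimension $k$ over $\mathbb{F}_{q^n}$, let $\mathcal{L}_{\mathcal{C}}$ be the set of all linear sets $L_{f_1,\dots,f_k}=L(\{(f_1(x),\dots,f_k(x)):x\in\mathbb{F}_{q^n}\})$ with $\mathcal{C}=\langle f_1,\dots,f_k\rangle_{\mathbb{F}_{q^n}}$. **Theorem.** All linear sets in $\mathcal{L}_{\mathcal{C}}$ have the same weight distribution with respect to hyperplanes, and this distribution determines that of the linear sets in $\mathcal{L}_{\mathcal{C}^\perp}$. Precisely: for every $k$ there is a map $\Phi:\mathbb{N}^n\to\mathbb{N}^n$ such that for every $k$-dimensional $\mathbb{F}_{q^n}$-subspace $\mathcal{C}$ of $V$, every $L\in\mathcal{L}_{\mathcal{C}}$ and every $M\in\mathcal{L}_{\mathcal{C}^\perp}$, $$w(M)=\Phi(w(L)),$$ where in the degenerate case $k=1$ it is assumed in addition that $L$ has rank $n$. -/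

import Mathlib

open Module

namespace LinSet

/-- An `𝔽_q`-linear set `L(U)` in `PG(k-1, q^n)` (`K = 𝔽_q`, `L = 𝔽_{q^n}`).  The weight of a
subspace with respect to `L(U)` depends on `U`, so a linear set is recorded together with the
`𝔽_q`-subspace `U` of `V(k, q^n)` that defines it. -/
@[ext]
structure LinearSet (K L : Type*) [Field K] [Field L] [Algebra K L] (k : ℕ) where
  /-- The defining `𝔽_q`-subspace `U`. -/
  U : Submodule K (Fin k → L)

namespace LinearSet

variable {K L : Type*} [Field K] [Field L] [Algebra K L] {k : ℕ}

/-- The point set `{⟨u⟩ : u ∈ U, u ≠ 0}` of `L(U)` in `PG(k-1, q^n)`. -/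
def points (Λ : LinearSet K L k) : Set (Projectivization L (Fin k → L)) :=
  {P | ∃ u : Fin k → L, ∃ hu : u ≠ 0, u ∈ Λ.U ∧ P = Projectivization.mk L u hu}

/-- The rank of `L(U)`. -/
noncomputable def rank (Λ : LinearSet K L k) : ℕ := finrank K Λ.U

/-- The weight `dim_{𝔽_q} (U ∩ W)` of `PG(W)` with respect to `L(U)`. -/
noncomputable def weight (Λ : LinearSet K L k) (W : Submodule L (Fin k → L)) : ℕ :=
  finrank K (Λ.U ⊓ W.restrictScalars K : Submodule K (Fin k → L))

/-- The weight distribution `(v_1, …, v_n)` with respect to hyperplanes, `n = [L : K]`: `v_i` is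
the number of hyperplanes `PG(W)` of `PG(k-1, q^n)` that have weight `i`.  The entry `v_i` is
stored at the index `i - 1`. -/
noncomputable def hyperplaneWeightDistribution (Λ : LinearSet K L k) :
    Fin (finrank K L) → ℕ :=
  fun i => {W : Submodule L (Fin k → L) | finrank L W + 1 = k ∧ Λ.weight W = i + 1}.ncard

end LinearSet

section Codes

variable (K L : Type*) [Field K] [Fintype K] [Field L] [Algebra K L]

/-- The linearised polynomial `x ↦ ∑_{i < n} α_i x^{q^i}` as an element of
`V = End_{𝔽_q}(𝔽_{q^n})`, as an `𝔽_{q^n}`-linear function of its coefficient vector `α`.  The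
`𝔽_{q^n}`-structure on `V` is `(c • f)(x) = c * f(x)`. -/
noncomputable def linPoly : (Fin (finrank K L) → L) →ₗ[L] (L →ₗ[K] L) :=
  Fintype.linearCombination L
    fun i : Fin (finrank K L) => ((FiniteField.frobeniusAlgHom K L) ^ (i : ℕ)).toLinearMap

theorem linPoly_apply (a : Fin (finrank K L) → L) (x : L) :
    linPoly K L a x = ∑ i, a i * x ^ Fintype.card K ^ (i : ℕ) := by
  simp [linPoly, Fintype.linearCombination_apply, FiniteField.coe_frobeniusAlgHom, pow_iterate]

variable {K L}

/-- The Delsarte dual `C^⊥` of an `𝔽_{q^n}`-subspace `C` of `V`: all linearised polynomials `g`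
with `∑ f_i g_i = 0` for every linearised polynomial `f` in `C`. -/
noncomputable def dual (C : Submodule L (L →ₗ[K] L)) : Submodule L (L →ₗ[K] L) :=
  Submodule.map (linPoly K L)
    { carrier := {b | ∀ a, linPoly K L a ∈ C → a ⬝ᵥ b = 0}
      add_mem' := fun hx hy a ha => by rw [dotProduct_add, hx a ha, hy a ha, add_zero]
      zero_mem' := fun a _ => dotProduct_zero a
      smul_mem' := fun c x hx a ha => by rw [dotProduct_smul, hx a ha, smul_zero] }

/-- The linear set `L_{f_1,…,f_k}` defined by
`U_{f_1,…,f_k} = {(f_1(x), …, f_k(x)) : x ∈ 𝔽_{q^n}}`. -/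
def ofMaps {K L : Type*} [Field K] [Field L] [Algebra K L] {k : ℕ} (f : Fin k → (L →ₗ[K] L)) :
    LinearSet K L k :=
  ⟨LinearMap.range (LinearMap.pi f)⟩

/-- The set `𝓛_C` of the linear sets `L_{f_1,…,f_k}` in `PG(k-1, q^n)` with
`C = ⟨f_1, …, f_k⟩_{q^n}`, where `k = dim C`. -/
def linearSets {K L : Type*} [Field K] [Field L] [Algebra K L] (C : Submodule L (L →ₗ[K] L)) :
    Set (LinearSet K L (finrank L C)) :=
  {Λ | ∃ f : Fin (finrank L C) → (L →ₗ[K] L),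
    Submodule.span L (Set.range f) = C ∧ Λ = ofMaps f}

end Codes

end LinSet

/-! ### Multisets and triangular sums -/

namespace LinSet

/-! Write Q = |L|, n = [L : K], k = dim C, and let d be the dimension of the common kernel of C. If
C = ⟨f_1, …, f_k⟩, the f_i are independent, and a hyperplane a · w = 0 pulls back along (f_1, …,
f_k) to the kernel of g = ∑ a_i f_i. So its weight is the nullity of g minus d, and each hyperplane
arises from Q - 1 nonzero g in C. Hence the weight distribution amounts to the multiset of nullities
of the nonzero elements of C, shifted by d (`hyperplaneWeightDistribution_mul`, `relNullities_eq`).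

The shift is recovered by counting the pairs (g, x) with g x = 0, which gives a linear equation for
q^d, solvable unless k = 1 (`finrank_commonKernel_eq_of_relNullities_eq`). Thus the rank
distribution of C is known.

It remains to prove MacWilliams identities for the Delsarte dual. Let V_X be the maps vanishing on
X. The dual of V_X is V_Y, with Y the trace-orthogonal of X, so dim (C^⊥ ∩ V_Y) is known from dim (C
∩ V_X) (`finrank_dual_inf_vanishing`). Summing the sizes of these intersections over all X of fixed
dimension gives a unitriangular system for the nullities of C^⊥ (`sum_nullities_dual`,
`nullities_dual_eq`). -/

/-- A triangular family with ones on the diagonal separates multisets of natural numbers. -/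
theorem multiset_eq_of_triangular_sums {G : ℕ → ℕ → ℕ} (hlt : ∀ j t, j < t → G j t = 0)
    (hdiag : ∀ j, G j j = 1) :
    ∀ (s₁ s₂ : Multiset ℕ), (∀ t, (s₁.map (G · t)).sum = (s₂.map (G · t)).sum) → s₁ = s₂ := by
  -- At the index m, smaller elements contribute 0 and m contributes 1, so a common upper bound m
  -- lying in one multiset lies in the other. It can then be cancelled from both.
  have key : ∀ (s₁ s₂ : Multiset ℕ), (∀ t, (s₁.map (G · t)).sum = (s₂.map (G · t)).sum) →
      ∀ m ∈ s₁, (∀ j ∈ s₂, j ≤ m) → m ∈ s₂ := by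
    intro s₁ s₂ h m hm hmax
    by_contra hm2
    have h0 : (s₂.map (G · m)).sum = 0 := by
      apply Multiset.sum_eq_zero
      intro x hx
      obtain ⟨j, hj, rfl⟩ := Multiset.mem_map.1 hx
      exact hlt j m (lt_of_le_of_ne (hmax j hj) (fun e => hm2 (e ▸ hj)))
    have h1 : G m m ≤ (s₁.map (G · m)).sum :=
      Multiset.single_le_sum (fun _ _ => Nat.zero_le _) _ (Multiset.mem_map_of_mem _ hm)
    rw [h m, h0, hdiag] at h1
    omega
  intro s₁
  induction hc : s₁.card generalizing s₁ with
  | zero =>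
    intro s₂ h
    rw [Multiset.card_eq_zero] at hc
    subst hc
    symm
    rw [Multiset.eq_zero_iff_forall_notMem]
    intro m hm
    have h1 : G m m ≤ (s₂.map (G · m)).sum :=
      Multiset.single_le_sum (fun _ _ => Nat.zero_le _) _ (Multiset.mem_map_of_mem _ hm)
    rw [← h m, hdiag] at h1
    simp at h1
  | succ c ih =>
    intro s₂ h
    obtain ⟨a, ha⟩ := Multiset.card_pos_iff_exists_mem.1 (by omega : 0 < s₁.card)
    obtain ⟨m, hm, hmax⟩ := (s₁ + s₂).toFinset.exists_max_image id
      ⟨a, by simp [ha]⟩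
    simp only [Multiset.toFinset_add, Finset.mem_union, Multiset.mem_toFinset, id] at hm hmax
    have hm1 : m ∈ s₁ := hm.elim id fun h2 =>
      key s₂ s₁ (fun t => (h t).symm) m h2 fun j hj => hmax j (.inl hj)
    have hm2 : m ∈ s₂ := key s₁ s₂ h m hm1 fun j hj => hmax j (.inr hj)
    obtain ⟨r₁, rfl⟩ := Multiset.exists_cons_of_mem hm1
    obtain ⟨r₂, rfl⟩ := Multiset.exists_cons_of_mem hm2
    rw [ih r₁ (by simpa using hc) r₂ fun t => by simpa using h t]

/-! ### Sums over subspaces -/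

section Subspaces

variable (K : Type*) [Field K]

/-- The sum of `φ (dim X)` over all subspaces `X` of a `j`-dimensional space. -/
noncomputable def subspaceSum (φ : ℕ → ℕ) (j : ℕ) : ℕ :=
  ∑ᶠ X : Submodule K (Fin j → K), φ (finrank K X)

theorem finsum_submodule_le {V : Type*} [AddCommGroup V] [Module K V] [FiniteDimensional K V]
    (φ : ℕ → ℕ) (Y : Submodule K V) :
    ∑ᶠ X : Set.Iic Y, φ (finrank K X.1) = subspaceSum K φ (finrank K Y) := by
  have e : Y ≃ₗ[K] (Fin (finrank K Y) → K) :=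
    LinearEquiv.ofFinrankEq _ _ (by simp)
  rw [subspaceSum]
  symm
  apply finsum_eq_of_bijective ((Submodule.orderIsoMapComap e.symm).trans Y.mapIic)
    (OrderIso.bijective _)
  intro X
  congr 1
  rw [OrderIso.trans_apply, Submodule.coe_mapIic_apply, Submodule.finrank_map_subtype_eq]
  exact (LinearEquiv.finrank_map_eq e.symm X).symm

theorem subspaceSum_single_of_lt {j t : ℕ} (h : j < t) :
    subspaceSum K (fun i => if i = t then 1 else 0) j = 0 := by
  refine finsum_eq_zero_of_forall_eq_zero fun X => ?_
  have := X.finrank_le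
  simp only [finrank_fin_fun] at this
  exact if_neg (by omega)

theorem subspaceSum_single_self (j : ℕ) :
    subspaceSum K (fun i => if i = j then 1 else 0) j = 1 := by
  rw [subspaceSum, finsum_eq_single _ ⊤]
  · simp
  · intro X hX
    rw [if_neg]
    intro h
    exact hX (Submodule.eq_top_of_finrank_eq (by simpa using h))

end Subspaces

/-! ### Orthogonality for the dot product -/

section DotForm

variable {L : Type*} [Field L]

/-- The standard dot product as a bilinear form. -/
def dotForm (L : Type*) [Field L] (n : ℕ) : LinearMap.BilinForm L (Fin n → L) :=
  LinearMap.mk₂ L (fun a b => a ⬝ᵥ b) add_dotProduct smul_dotProduct dotProduct_add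
    (fun c a b => dotProduct_smul c a b)

@[simp] theorem dotForm_apply {n : ℕ} (a b : Fin n → L) : dotForm L n a b = a ⬝ᵥ b := rfl

theorem dotForm_nondegenerate (n : ℕ) : (dotForm L n).Nondegenerate :=
  ⟨fun a h => dotProduct_eq_zero a h,
    fun a h => dotProduct_eq_zero a fun b => by rw [dotProduct_comm]; exact h b⟩

theorem dotForm_isRefl (n : ℕ) : (dotForm L n).IsRefl := fun a b h => by
  rw [dotForm_apply] at *
  rwa [dotProduct_comm]

theorem finrank_orthogonal_add {n : ℕ} (A : Submodule L (Fin n → L)) :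
    finrank L ((dotForm L n).orthogonal A) + finrank L A = n := by
  have h := LinearMap.BilinForm.finrank_orthogonal (dotForm_nondegenerate (L := L) n) A
  have := A.finrank_le
  simp only [finrank_fin_fun] at *
  omega

theorem orthogonal_orthogonal_dotForm {n : ℕ} (A : Submodule L (Fin n → L)) :
    (dotForm L n).orthogonal ((dotForm L n).orthogonal A) = A :=
  LinearMap.BilinForm.orthogonal_orthogonal (dotForm_nondegenerate n) (dotForm_isRefl n) A

theorem finrank_orthogonal_inf_orthogonal {n : ℕ} (A E : Submodule L (Fin n → L)) :
    finrank L ((dotForm L n).orthogonal A ⊓ (dotForm L n).orthogonal E :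
      Submodule L (Fin n → L)) + finrank L A + finrank L E =
      n + finrank L (A ⊓ E : Submodule L (Fin n → L)) := by
  have h : (dotForm L n).orthogonal A ⊓ (dotForm L n).orthogonal E =
      (dotForm L n).orthogonal (A ⊔ E) := by
    apply le_antisymm
    · rintro x ⟨hA, hE⟩ y hy
      obtain ⟨a, ha, e, he, rfl⟩ := Submodule.mem_sup.1 hy
      change dotForm L n (a + e) x = 0
      rw [map_add, LinearMap.add_apply, hA a ha, hE e he, add_zero]
    · exact le_inf (LinearMap.BilinForm.orthogonal_le le_sup_left)
        (LinearMap.BilinForm.orthogonal_le le_sup_right)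
  have h1 := finrank_orthogonal_add (A ⊔ E)
  have h2 := Submodule.finrank_sup_add_finrank_inf_eq A E
  rw [h]
  omega

end DotForm

/-! ### Vanishing maps and coefficient vectors -/

section Vanishing

variable {K L : Type*} [Field K] [Field L] [Algebra K L]

/-- The `K`-linear maps `L → L` that vanish on `X`. -/
def vanishing (X : Submodule K L) : Submodule L (L →ₗ[K] L) :=
  LinearMap.ker (LinearMap.lcomp L L X.subtype)

theorem mem_vanishing {X : Submodule K L} {g : L →ₗ[K] L} :
    g ∈ vanishing X ↔ ∀ x ∈ X, g x = 0 := by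
  simp [vanishing, LinearMap.ext_iff]

theorem mem_vanishing_iff_le_ker {X : Submodule K L} {g : L →ₗ[K] L} :
    g ∈ vanishing X ↔ X ≤ LinearMap.ker g :=
  mem_vanishing

theorem finrank_vanishing_add [FiniteDimensional K L] (X : Submodule K L) :
    finrank L (vanishing X) + finrank K X = finrank K L := by
  have hsurj : LinearMap.range (LinearMap.lcomp L L X.subtype) = ⊤ := by
    rw [LinearMap.range_eq_top]
    intro f
    exact LinearMap.exists_extend f
  have h := LinearMap.finrank_range_add_finrank_ker (LinearMap.lcomp L L X.subtype)
  rw [hsurj, finrank_top, finrank_linearMap_self, finrank_linearMap_self] at h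
  rw [vanishing]
  omega

end Vanishing

section Coeffs

variable {K L : Type*} [Field K] [Fintype K] [Field L] [Algebra K L]

/-- The coefficient vectors of the linearised polynomials in `C`. -/
noncomputable def coeffs (C : Submodule L (L →ₗ[K] L)) : Submodule L (Fin (finrank K L) → L) :=
  C.comap (linPoly K L)

theorem mem_coeffs {C : Submodule L (L →ₗ[K] L)} {a : Fin (finrank K L) → L} :
    a ∈ coeffs C ↔ linPoly K L a ∈ C := Iff.rfl

end Coeffs

/-! ### Delsarte duality and the trace form -/

section Dual

variable (K L : Type*) [Field K] [Fintype K] [Field L] [Finite L] [Algebra K L]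

/-- The powers of Frobenius below n are distinct, hence independent by Dedekind's lemma. -/
theorem linPoly_injective : Function.Injective (linPoly K L) := by
  have h := (linearIndependent_toLinearMap K L L).comp _
    (FiniteField.bijective_frobeniusAlgHom_pow K L).1
  exact LinearMap.ker_eq_bot.1 (linearIndependent_iff_injective_fintypeLinearCombination.1 h |>
    LinearMap.ker_eq_bot.2)

/-- Every `K`-linear map `L → L` is given by a unique linearised polynomial. -/
noncomputable def linPolyEquiv : (Fin (finrank K L) → L) ≃ₗ[L] (L →ₗ[K] L) :=
  LinearEquiv.ofBijective (linPoly K L) ⟨linPoly_injective K L,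
    (LinearMap.injective_iff_surjective_of_finrank_eq_finrank
      (by rw [finrank_fin_fun, finrank_linearMap_self])).1 (linPoly_injective K L)⟩

variable {K L}

theorem finrank_coeffs (C : Submodule L (L →ₗ[K] L)) : finrank L (coeffs C) = finrank L C := by
  have h : C = (coeffs C).map (linPolyEquiv K L).toLinearMap :=
    (Submodule.map_comap_eq_of_surjective (linPolyEquiv K L).surjective C).symm
  conv_rhs => rw [h]
  exact (LinearEquiv.finrank_map_eq (linPolyEquiv K L) _).symm

theorem coeffs_dual (C : Submodule L (L →ₗ[K] L)) :
    coeffs (dual C) = (dotForm L _).orthogonal (coeffs C) := by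
  rw [coeffs, dual, Submodule.comap_map_eq_of_injective (linPoly_injective K L)]
  rfl

theorem finrank_dual_add (C : Submodule L (L →ₗ[K] L)) :
    finrank L (dual C) + finrank L C = finrank K L := by
  rw [← finrank_coeffs, ← finrank_coeffs C, coeffs_dual]
  exact finrank_orthogonal_add _

/-- The orthogonal complement with respect to the trace form. -/
noncomputable def traceDual (X : Submodule K L) : Submodule K L :=
  (Algebra.traceForm K L).orthogonal X

theorem finrank_traceDual_add (X : Submodule K L) :
    finrank K (traceDual X) + finrank K X = finrank K L := by
  have h := LinearMap.BilinForm.finrank_orthogonal (traceForm_nondegenerate K L) X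
  have := X.finrank_le
  rw [traceDual]
  omega

theorem traceDual_traceDual (X : Submodule K L) : traceDual (traceDual X) = X :=
  LinearMap.BilinForm.orthogonal_orthogonal (traceForm_nondegenerate K L)
    (Algebra.traceForm_isSymm K).isRefl X

theorem sum_pow_mul_pow_eq_trace (x y : L) :
    ∑ i : Fin (finrank K L), x ^ Fintype.card K ^ (i : ℕ) * y ^ Fintype.card K ^ (i : ℕ) =
      algebraMap K L (Algebra.trace K L (x * y)) := by
  rw [FiniteField.algebraMap_trace_eq_sum_pow, Finset.sum_range, Nat.card_eq_fintype_card]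
  simp_rw [mul_pow]

/-- The pairing of (x^{q^i}) with (y^{q^i}) is Tr(xy), so for x in X these vectors are coefficients
of maps vanishing on the trace dual. Their span is the orthogonal of the coefficients of V_X, and
dimensions agree. -/
theorem coeffs_vanishing_traceDual (X : Submodule K L) :
    coeffs (vanishing (traceDual X)) = (dotForm L _).orthogonal (coeffs (vanishing X)) := by
  set M : Submodule L (Fin (finrank K L) → L) :=
    Submodule.span L ((fun x : L => fun i => x ^ Fintype.card K ^ (i : ℕ)) '' (X : Set L)) with hM
  have h1 : M ≤ coeffs (vanishing (traceDual X)) := by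
    rw [hM, Submodule.span_le]
    rintro _ ⟨x, hx, rfl⟩
    refine mem_coeffs.2 (mem_vanishing.2 fun y hy => ?_)
    rw [linPoly_apply, sum_pow_mul_pow_eq_trace, ← Algebra.traceForm_apply, hy x hx, map_zero]
  have h2 : (dotForm L _).orthogonal M = coeffs (vanishing X) := by
    apply le_antisymm
    · intro a ha
      refine mem_coeffs.2 (mem_vanishing.2 fun x hx => ?_)
      rw [linPoly_apply]
      have h := ha _ (Submodule.subset_span ⟨x, hx, rfl⟩)
      rw [dotForm_apply, dotProduct_comm] at h
      exact h
    · have h : M ≤ (dotForm L _).orthogonal (coeffs (vanishing X)) := by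
        rw [hM, Submodule.span_le]
        rintro _ ⟨x, hx, rfl⟩ a ha
        have h := mem_vanishing.1 (mem_coeffs.1 ha) x hx
        rwa [linPoly_apply] at h
      simpa only [orthogonal_orthogonal_dotForm] using LinearMap.BilinForm.orthogonal_le
        (B := dotForm L _) h
  have h3 := finrank_orthogonal_add M
  have h4 := finrank_vanishing_add X
  have h5 := finrank_vanishing_add (traceDual X)
  have h6 := finrank_traceDual_add X
  rw [h2, finrank_coeffs] at h3
  rw [← h2, orthogonal_orthogonal_dotForm]
  exact (Submodule.eq_of_le_of_finrank_eq h1 (by rw [finrank_coeffs]; omega)).symm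

/-- The first intersection is the dual of C + V_X, and dim V_X = n - dim X. -/
theorem finrank_dual_inf_vanishing (C : Submodule L (L →ₗ[K] L)) (X : Submodule K L) :
    finrank L (dual C ⊓ vanishing (traceDual X) : Submodule L (L →ₗ[K] L)) + finrank L C =
      finrank K X + finrank L (C ⊓ vanishing X : Submodule L (L →ₗ[K] L)) := by
  have h := finrank_orthogonal_inf_orthogonal (coeffs C) (coeffs (vanishing X))
  have h4 := finrank_vanishing_add X
  have hinf : ∀ A B : Submodule L (L →ₗ[K] L), coeffs A ⊓ coeffs B = coeffs (A ⊓ B) :=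
    fun _ _ => rfl
  rw [← coeffs_dual, ← coeffs_vanishing_traceDual, hinf, hinf, finrank_coeffs, finrank_coeffs,
    finrank_coeffs, finrank_coeffs] at h
  omega

end Dual

/-! ### Nullities and the MacWilliams identities -/

section Nullities

variable {K L : Type*} [Field K] [Field L] [Finite L] [Algebra K L]

instance finite_linearMap : Finite (L →ₗ[K] L) := DFunLike.finite _

/-- The elements of `C` as a finite set. -/
noncomputable def members (C : Submodule L (L →ₗ[K] L)) : Finset (L →ₗ[K] L) :=
  (Set.toFinite (C : Set (L →ₗ[K] L))).toFinset

@[simp] theorem mem_members {C : Submodule L (L →ₗ[K] L)} {g : L →ₗ[K] L} :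
    g ∈ members C ↔ g ∈ C := by
  simp [members]

/-- The dimension of the kernel. -/
noncomputable def nullity (g : L →ₗ[K] L) : ℕ := finrank K (LinearMap.ker g)

/-- The multiset of the nullities of the elements of `C`. -/
noncomputable def nullities (C : Submodule L (L →ₗ[K] L)) : Multiset ℕ :=
  (members C).val.map nullity

theorem sum_map_nullities (C : Submodule L (L →ₗ[K] L)) (φ : ℕ → ℕ) :
    ((nullities C).map φ).sum = ∑ g ∈ members C, φ (nullity g) := by
  rw [nullities, Multiset.map_map]
  rfl

theorem card_members (C : Submodule L (L →ₗ[K] L)) :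
    (members C).card = Nat.card L ^ finrank L C := by
  rw [members, ← Set.ncard_eq_toFinset_card]
  exact natCard_eq_pow_finrank (K := L) (V := C)

-- Double counting of the pairs X ≤ ker g with g in C, weighted by φ (dim X).
open Classical in
theorem finsum_card_inf_vanishing (C : Submodule L (L →ₗ[K] L)) (φ : ℕ → ℕ) :
    ∑ᶠ X : Submodule K L, φ (finrank K X) *
        Nat.card L ^ finrank L (C ⊓ vanishing X : Submodule L (L →ₗ[K] L)) =
      ((nullities C).map (subspaceSum K φ)).sum := by
  have := Fintype.ofFinite (Submodule K L)
  have h1 (X : Submodule K L) :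
      Nat.card L ^ finrank L (C ⊓ vanishing X : Submodule L (L →ₗ[K] L)) =
        ∑ g ∈ members C, if X ≤ LinearMap.ker g then 1 else 0 := by
    rw [← card_members, ← Finset.card_filter]
    congr 1
    ext g
    simp [mem_vanishing_iff_le_ker]
  rw [finsum_eq_sum_of_fintype, sum_map_nullities]
  simp_rw [h1, Finset.mul_sum]
  rw [Finset.sum_comm]
  refine Finset.sum_congr rfl fun g _ => ?_
  rw [nullity, ← finsum_submodule_le, finsum_eq_sum_of_fintype]
  simp_rw [mul_ite, mul_one, mul_zero]
  rw [← Finset.sum_filter]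
  exact (Finset.sum_subtype _ (by simp) _)

theorem nullity_le (g : L →ₗ[K] L) : nullity g ≤ finrank K L := by
  exact Submodule.finrank_le _

end Nullities

section MacWilliams

variable {K L : Type*} [Field K] [Fintype K] [Field L] [Finite L] [Algebra K L]

/-- Both sides are sums over X, matched by the involution X ↦ `traceDual X`; the factor Q^t is the
dim X term of `finrank_dual_inf_vanishing`. -/
theorem sum_nullities_dual (C : Submodule L (L →ₗ[K] L)) (φ : ℕ → ℕ) :
    ((nullities (dual C)).map (subspaceSum K φ)).sum * Nat.card L ^ finrank L C =
      ((nullities C).map (subspaceSum K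
        fun t => φ (finrank K L - t) * Nat.card L ^ t)).sum := by
  rw [← finsum_card_inf_vanishing, ← finsum_card_inf_vanishing, finsum_mul]
  refine (finsum_eq_of_bijective traceDual
    (Function.Involutive.bijective traceDual_traceDual) fun X => ?_).symm
  have h1 := finrank_traceDual_add X
  rw [mul_assoc, mul_assoc, ← pow_add, ← pow_add, finrank_dual_inf_vanishing,
    ← h1, Nat.add_sub_cancel]

/-- The rank distribution of a code determines that of its Delsarte dual. -/
theorem nullities_dual_eq {C₁ C₂ : Submodule L (L →ₗ[K] L)}
    (hk : finrank L C₁ = finrank L C₂) (h : nullities C₁ = nullities C₂) :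
    nullities (dual C₁) = nullities (dual C₂) := by
  -- With φ the indicator of t, `subspaceSum` is the Gaussian binomial [j, t], which is
  -- unitriangular.
  refine multiset_eq_of_triangular_sums
    (G := fun j t => subspaceSum K (fun i => if i = t then 1 else 0) j)
    (fun _ _ => subspaceSum_single_of_lt K) (subspaceSum_single_self K) _ _ fun t => ?_
  have h1 := sum_nullities_dual C₁ fun i => if i = t then 1 else 0
  rw [h, ← sum_nullities_dual C₂ fun i => if i = t then 1 else 0, hk] at h1
  exact Nat.eq_of_mul_eq_mul_right (pow_pos Nat.card_pos _) h1

end MacWilliams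

/-! ### From hyperplanes to elements of the code -/

section CommonKernel

variable {K L : Type*} [Field K] [Field L] [Algebra K L]

/-- The intersection of the kernels of the elements of `C`. -/
def commonKernel (C : Submodule L (L →ₗ[K] L)) : Submodule K L :=
  ⨅ g ∈ C, LinearMap.ker g

theorem commonKernel_le {C : Submodule L (L →ₗ[K] L)} {g : L →ₗ[K] L} (hg : g ∈ C) :
    commonKernel C ≤ LinearMap.ker g :=
  iInf₂_le g hg

theorem nullity_zero : nullity (0 : L →ₗ[K] L) = finrank K L := by
  rw [nullity, LinearMap.ker_zero, finrank_top]

theorem commonKernel_span {k : ℕ} (f : Fin k → (L →ₗ[K] L)) :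
    commonKernel (Submodule.span L (Set.range f)) = LinearMap.ker (LinearMap.pi f) := by
  apply le_antisymm
  · intro x hx
    rw [LinearMap.mem_ker]
    ext i
    exact commonKernel_le (Submodule.subset_span (Set.mem_range_self i)) hx
  · refine le_iInf₂ fun g hg x hx => ?_
    have h : Submodule.span L (Set.range f) ≤ vanishing (LinearMap.ker (LinearMap.pi f)) := by
      rw [Submodule.span_le]
      rintro _ ⟨i, rfl⟩
      exact mem_vanishing.2 fun y hy => congrFun (LinearMap.mem_ker.1 hy) i
    exact mem_vanishing.1 (h hg) x hx

theorem rank_add_finrank_commonKernel [FiniteDimensional K L] {C : Submodule L (L →ₗ[K] L)}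
    {Λ : LinearSet K L (finrank L C)} (hΛ : Λ ∈ linearSets C) :
    Λ.rank + finrank K (commonKernel C) = finrank K L := by
  obtain ⟨f, hf, rfl⟩ := hΛ
  have h := commonKernel_span f
  rw [hf] at h
  rw [h]
  exact LinearMap.finrank_range_add_finrank_ker (LinearMap.pi f)

/-- The hyperplane through `W = ker (a ⬝ᵥ ·)` has the weight of the map `∑ i, a i • f i`, up to
the dimension of the common kernel. -/
theorem nullity_linearCombination [FiniteDimensional K L] {k : ℕ}
    (f : Fin k → (L →ₗ[K] L)) (a : Fin k → L) :
    nullity (Fintype.linearCombination L f a) =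
      (ofMaps f).weight ((dotForm L k).orthogonal (Submodule.span L {a})) +
        finrank K (commonKernel (Submodule.span L (Set.range f))) := by
  have hmem (w : Fin k → L) :
      w ∈ (dotForm L k).orthogonal (Submodule.span L {a}) ↔ a ⬝ᵥ w = 0 := by
    rw [LinearMap.BilinForm.orthogonal_span_singleton_eq_toLin_ker]
    rfl
  have happ (x : L) : Fintype.linearCombination L f a x = a ⬝ᵥ (LinearMap.pi f x) := by
    simp [Fintype.linearCombination_apply, dotProduct]
  set g := Fintype.linearCombination L f a with hg
  set p : LinearMap.ker g →ₗ[K] (Fin k → L) := (LinearMap.pi f).domRestrict (LinearMap.ker g)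
  have h := LinearMap.finrank_range_add_finrank_ker p
  have hr : LinearMap.range p = (ofMaps f).U ⊓
      ((dotForm L k).orthogonal (Submodule.span L {a})).restrictScalars K := by
    ext w
    constructor
    · rintro ⟨⟨x, hx⟩, rfl⟩
      exact ⟨⟨x, rfl⟩, (hmem _).2 ((happ x).symm.trans hx)⟩
    · rintro ⟨⟨x, rfl⟩, hw⟩
      exact ⟨⟨x, (happ x).trans ((hmem _).1 hw)⟩, rfl⟩
  have hk : finrank K (LinearMap.ker p) =
      finrank K (commonKernel (Submodule.span L (Set.range f))) := by
    rw [commonKernel_span, LinearMap.ker_domRestrict, ← Submodule.finrank_map_subtype_eq,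
      Submodule.map_comap_subtype, inf_eq_right.2]
    rw [← commonKernel_span]
    refine commonKernel_le ?_
    rw [hg, ← Fintype.range_linearCombination]
    exact ⟨a, rfl⟩
  rw [nullity, LinearSet.weight, ← hr, ← hk, h]

end CommonKernel

section Count

variable {L : Type*} [Field L] [Finite L]

/-- Every hyperplane is the kernel of `|L| - 1` nonzero functionals. -/
theorem ncard_functionals {k : ℕ} (p : Submodule L (Fin k → L) → Prop) :
    {a : Fin k → L | a ≠ 0 ∧ p ((dotForm L k).orthogonal (Submodule.span L {a}))}.ncard =
      {W : Submodule L (Fin k → L) | finrank L W + 1 = k ∧ p W}.ncard * (Nat.card L - 1) := by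
  classical
  have := Fintype.ofFinite L
  have := Fintype.ofFinite (Submodule L (Fin k → L))
  let τ : (Fin k → L) → Submodule L (Fin k → L) :=
    fun a => (dotForm L k).orthogonal (Submodule.span L {a})
  rw [Set.ncard_eq_toFinset_card', Set.ncard_eq_toFinset_card',
    Finset.card_eq_sum_card_fiberwise (f := τ)
      (t := {W : Submodule L (Fin k → L) | finrank L W + 1 = k ∧ p W}.toFinset)]
  · rw [Finset.sum_const_nat]
    intro W hW
    simp only [Set.mem_toFinset, Set.mem_ofPred_eq] at hW
    have h1 : finrank L ((dotForm L k).orthogonal W) = 1 := by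
      have := finrank_orthogonal_add W
      omega
    -- The fibre over W is the line orthogonal to W without its origin.
    have h2 : Finset.filter (τ · = W)
        {a : Fin k → L | a ≠ 0 ∧ p ((dotForm L k).orthogonal (Submodule.span L {a}))}.toFinset =
        (((dotForm L k).orthogonal W : Set (Fin k → L)).toFinset).erase 0 := by
      ext a
      simp only [Finset.mem_filter, Set.mem_toFinset, Set.mem_ofPred_eq, Finset.mem_erase,
        SetLike.mem_coe]
      constructor
      · rintro ⟨⟨ha, -⟩, rfl⟩
        refine ⟨ha, ?_⟩
        rw [orthogonal_orthogonal_dotForm]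
        exact Submodule.mem_span_singleton_self a
      · rintro ⟨ha, haW⟩
        have h3 : Submodule.span L {a} = (dotForm L k).orthogonal W :=
          Submodule.eq_of_le_of_finrank_eq (by simpa using haW)
            (by rw [h1, finrank_span_singleton ha])
        have h4 : τ a = W := by
          simp only [τ]
          rw [h3, orthogonal_orthogonal_dotForm]
        exact ⟨⟨ha, by rw [show (dotForm L k).orthogonal (Submodule.span L {a}) = W from h4]
                       exact hW.2⟩, h4⟩
    rw [h2, Finset.card_erase_of_mem (by simp), ← Set.ncard_eq_toFinset_card']
    congr 1
    have h5 := natCard_eq_pow_finrank (K := L) (V := (dotForm L k).orthogonal W)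
    rw [h1, pow_one] at h5
    exact h5
  · intro a ha
    simp only [Set.coe_toFinset, Set.mem_ofPred_eq] at ha ⊢
    refine ⟨?_, ha.2⟩
    have := finrank_orthogonal_add (Submodule.span L {a})
    rwa [finrank_span_singleton ha.1] at this

end Count

/-! ### Weight distributions and relative nullities -/

section Weights

variable {K L : Type*} [Field K] [Field L] [Finite L] [Algebra K L]

theorem finrank_commonKernel_le_nullity {C : Submodule L (L →ₗ[K] L)} {g : L →ₗ[K] L}
    (hg : g ∈ C) : finrank K (commonKernel C) ≤ nullity g :=
  Submodule.finrank_mono (commonKernel_le hg)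

open Classical in
/-- The multiset of the nullities of the nonzero elements of `C`, reduced by the dimension of the
common kernel. -/
noncomputable def relNullities (C : Submodule L (L →ₗ[K] L)) : Multiset ℕ :=
  ((members C).erase 0).val.map fun g => nullity g - finrank K (commonKernel C)

theorem nullities_eq_cons (C : Submodule L (L →ₗ[K] L)) :
    nullities C = finrank K L ::ₘ (relNullities C).map (· + finrank K (commonKernel C)) := by
  classical
  have h0 : (members C).val = (0 : L →ₗ[K] L) ::ₘ ((members C).erase 0).val := by
    rw [Finset.erase_val, Multiset.cons_erase]
    simp
  rw [nullities, h0, Multiset.map_cons, nullity_zero, relNullities, Multiset.map_map]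
  congr 1
  refine Multiset.map_congr (by congr!) fun g hg => ?_
  rw [Finset.mem_val, Finset.mem_erase, mem_members] at hg
  exact (Nat.sub_add_cancel (finrank_commonKernel_le_nullity hg.2)).symm

theorem card_nullities (C : Submodule L (L →ₗ[K] L)) :
    (nullities C).card = Nat.card L ^ finrank L C := by
  rw [nullities, Multiset.card_map]
  exact card_members C

theorem card_relNullities_add_one (C : Submodule L (L →ₗ[K] L)) :
    (relNullities C).card + 1 = Nat.card L ^ finrank L C := by
  rw [← card_nullities, nullities_eq_cons, Multiset.card_cons, Multiset.card_map]

theorem count_relNullities (C : Submodule L (L →ₗ[K] L)) (j : ℕ) :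
    (relNullities C).count j =
      {g | g ∈ C ∧ g ≠ 0 ∧ nullity g = j + finrank K (commonKernel C)}.ncard := by
  classical
  rw [relNullities, Multiset.count_map, Set.ncard_eq_toFinset_card _ (Set.toFinite _)]
  change (Finset.filter (fun g => j = nullity g - finrank K (commonKernel C)) _).card = _
  congr 1
  ext g
  simp only [Finset.mem_filter, Finset.mem_erase, mem_members, Set.Finite.mem_toFinset,
    Set.mem_ofPred_eq]
  constructor
  · rintro ⟨⟨h0, hg⟩, rfl⟩
    exact ⟨hg, h0, (Nat.sub_add_cancel (finrank_commonKernel_le_nullity hg)).symm⟩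
  · rintro ⟨hg, h0, h⟩
    exact ⟨⟨h0, hg⟩, by omega⟩

/-- The hyperplanes of weight `i + 1` correspond to the nonzero maps in `C`, up to scalars, of
nullity `i + 1 + d`, where `d` is the dimension of the common kernel. -/
theorem hyperplaneWeightDistribution_mul {C : Submodule L (L →ₗ[K] L)}
    {Λ : LinearSet K L (finrank L C)} (hΛ : Λ ∈ linearSets C) (i : Fin (finrank K L)) :
    Λ.hyperplaneWeightDistribution i * (Nat.card L - 1) = (relNullities C).count (i + 1 : ℕ) := by
  rw [count_relNullities]
  obtain ⟨f, hf, rfl⟩ := hΛ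
  have hrange : LinearMap.range (Fintype.linearCombination L f) = C := by
    rw [Fintype.range_linearCombination, hf]
  -- The k maps span a space of dimension k, so they are independent.
  have hinj : Function.Injective (Fintype.linearCombination L f) := by
    refine linearIndependent_iff_injective_fintypeLinearCombination.1 ?_
    rw [linearIndependent_iff_card_eq_finrank_span, Set.finrank, hf, Fintype.card_fin]
  have hnull (a) := nullity_linearCombination f a
  rw [hf] at hnull
  rw [LinearSet.hyperplaneWeightDistribution,
    ← ncard_functionals fun W => (ofMaps f).weight W = i + 1, ← Set.ncard_image_of_injective _ hinj]
  congr 1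
  ext g
  constructor
  · rintro ⟨a, ⟨ha, hw⟩, rfl⟩
    refine ⟨?_, fun h => ha (hinj (h.trans (map_zero _).symm)), by rw [hnull, hw]⟩
    exact hrange.le (LinearMap.mem_range_self _ a)
  · rintro ⟨hg, hg0, hn⟩
    obtain ⟨a, rfl⟩ := hrange.ge hg
    refine ⟨a, ⟨?_, ?_⟩, rfl⟩
    · rintro rfl
      exact hg0 (map_zero _)
    · rw [hnull] at hn
      omega

theorem hyperplaneWeightDistribution_eq {C₁ C₂ : Submodule L (L →ₗ[K] L)}
    {Λ₁ : LinearSet K L (finrank L C₁)} {Λ₂ : LinearSet K L (finrank L C₂)}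
    (h₁ : Λ₁ ∈ linearSets C₁) (h₂ : Λ₂ ∈ linearSets C₂) (h : relNullities C₁ = relNullities C₂) :
    Λ₁.hyperplaneWeightDistribution = Λ₂.hyperplaneWeightDistribution := by
  ext i
  have hQ : 0 < Nat.card L - 1 := Nat.sub_pos_of_lt Finite.one_lt_card
  apply Nat.eq_of_mul_eq_mul_right hQ
  rw [hyperplaneWeightDistribution_mul h₁, hyperplaneWeightDistribution_mul h₂, h]

theorem multiset_eq_of_count_eq_of_card_eq {α : Type*} [DecidableEq α] (a : α) {s t : Multiset α}
    (hcard : s.card = t.card) (h : ∀ b ≠ a, s.count b = t.count b) : s = t := by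
  have h1 : s.filter (¬ · = a) = t.filter (¬ · = a) := by
    ext b
    rw [Multiset.count_filter, Multiset.count_filter]
    by_cases hb : b = a
    · simp [hb]
    · simp [hb, h b hb]
  have hs := Multiset.filter_add_not (· = a) s
  have ht := Multiset.filter_add_not (· = a) t
  rw [Multiset.filter_eq'] at hs ht
  have hs' := congrArg Multiset.card hs
  have ht' := congrArg Multiset.card ht
  rw [Multiset.card_add, Multiset.card_replicate] at hs' ht'
  rw [← hs, ← ht, h1, show s.count a = t.count a by rw [h1] at hs'; omega]

/-- The distribution does not record weight 0; its multiplicity follows from the total Q^k - 1. -/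
theorem relNullities_eq {C₁ C₂ : Submodule L (L →ₗ[K] L)}
    {Λ₁ : LinearSet K L (finrank L C₁)} {Λ₂ : LinearSet K L (finrank L C₂)}
    (h₁ : Λ₁ ∈ linearSets C₁) (h₂ : Λ₂ ∈ linearSets C₂) (hk : finrank L C₁ = finrank L C₂)
    (h : Λ₁.hyperplaneWeightDistribution = Λ₂.hyperplaneWeightDistribution) :
    relNullities C₁ = relNullities C₂ := by
  have hlarge (C : Submodule L (L →ₗ[K] L)) {j : ℕ} (hj : finrank K L < j) :
      (relNullities C).count j = 0 := by
    rw [count_relNullities, Set.ncard_eq_zero, Set.eq_empty_iff_forall_notMem]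
    rintro g ⟨-, -, hg⟩
    have := nullity_le g
    omega
  have c₁ := card_relNullities_add_one C₁
  have c₂ := card_relNullities_add_one C₂
  rw [hk] at c₁
  refine multiset_eq_of_count_eq_of_card_eq 0 (by omega) fun j hj => ?_
  obtain hn | hn := Nat.lt_or_ge (finrank K L) j
  · rw [hlarge _ hn, hlarge _ hn]
  · obtain ⟨i, rfl⟩ := Nat.exists_eq_succ_of_ne_zero hj
    have e₁ := hyperplaneWeightDistribution_mul h₁ ⟨i, hn⟩
    have e₂ := hyperplaneWeightDistribution_mul h₂ ⟨i, hn⟩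
    rw [h, e₂] at e₁
    exact e₁.symm

end Weights

/-! ### Recovering the dimension of the common kernel -/

section CommonKernelDimension

variable {K L : Type*} [Field K] [Field L] [Finite L] [Algebra K L]

/-- The maps killing x form a hyperplane of End_K(L) that does not contain C. -/
theorem finrank_inf_vanishing_span_singleton {C : Submodule L (L →ₗ[K] L)} {x : L}
    (hx : x ∉ commonKernel C) :
    finrank L (C ⊓ vanishing (Submodule.span K {x}) : Submodule L (L →ₗ[K] L)) + 1 =
      finrank L C := by
  have hx0 : x ≠ 0 := fun h => hx (h ▸ Submodule.zero_mem _)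
  set H : Submodule L (L →ₗ[K] L) := vanishing (Submodule.span K {x})
  have hH : finrank L H + 1 = finrank K L := by
    rw [← finrank_vanishing_add (Submodule.span K {x}), finrank_span_singleton hx0]
  have hlt : H < C ⊔ H := by
    refine lt_of_le_of_ne le_sup_right fun he => hx ?_
    refine (Submodule.mem_iInf _).2 fun g => (Submodule.mem_iInf _).2 fun hg => ?_
    have hgH : g ∈ H := he ▸ Submodule.mem_sup_left hg
    exact mem_vanishing_iff_le_ker.1 hgH (Submodule.mem_span_singleton_self x)
  have h1 := Submodule.finrank_lt_finrank_of_lt hlt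
  have h2 := (C ⊔ H).finrank_le
  rw [finrank_linearMap_self] at h2
  have h3 := Submodule.finrank_sup_add_finrank_inf_eq C H
  omega

open Classical in
/-- Double counting of the pairs `(g, x)` with `g ∈ C` and `g x = 0`. -/
theorem sum_card_pow_nullity (C : Submodule L (L →ₗ[K] L)) {k : ℕ} (hk : finrank L C = k + 1) :
    ((nullities C).map (Nat.card K ^ ·)).sum +
        Nat.card K ^ finrank K (commonKernel C) * Nat.card L ^ k =
      Nat.card K ^ finrank K (commonKernel C) * Nat.card L ^ (k + 1) + Nat.card L ^ (k + 1) := by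
  have := Fintype.ofFinite L
  have hcard (X : Submodule K L) : Nat.card K ^ finrank K X = ∑ x : L, if x ∈ X then 1 else 0 := by
    rw [← natCard_eq_pow_finrank, ← Finset.card_filter, Nat.card_eq_fintype_card,
      Fintype.card_subtype]
  have hpoint (x : L) : (∑ g ∈ members C, if x ∈ LinearMap.ker g then 1 else 0) +
      (if x ∈ commonKernel C then 1 else 0) * Nat.card L ^ k =
      (if x ∈ commonKernel C then 1 else 0) * Nat.card L ^ (k + 1) + Nat.card L ^ k := by
    have h1 : (∑ g ∈ members C, if x ∈ LinearMap.ker g then 1 else 0) =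
        Nat.card L ^ finrank L
          (C ⊓ vanishing (Submodule.span K {x}) : Submodule L (L →ₗ[K] L)) := by
      rw [← card_members, ← Finset.card_filter]
      congr 1
      ext g
      simp [mem_vanishing_iff_le_ker]
    rw [h1]
    by_cases hx : x ∈ commonKernel C
    · rw [if_pos hx, inf_eq_left.2, hk]
      · ring
      · intro g hg
        rw [mem_vanishing_iff_le_ker, Submodule.span_singleton_le_iff_mem]
        exact commonKernel_le hg hx
    · have h2 := finrank_inf_vanishing_span_singleton hx
      rw [if_neg hx, show finrank L (C ⊓ vanishing (Submodule.span K {x}) :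
        Submodule L (L →ₗ[K] L)) = k by omega]
      ring
  rw [sum_map_nullities]
  simp_rw [nullity, hcard]
  rw [Finset.sum_comm, Finset.sum_mul, ← Finset.sum_add_distrib,
    Finset.sum_congr rfl fun x _ => hpoint x, Finset.sum_add_distrib, ← Finset.sum_mul,
    Finset.sum_const, Finset.card_univ, ← Nat.card_eq_fintype_card, smul_eq_mul, pow_succ' _ k]

theorem eq_of_finrank_eq_zero {C₁ C₂ : Submodule L (L →ₗ[K] L)} (h₁ : finrank L C₁ = 0)
    (h₂ : finrank L C₂ = 0) : C₁ = C₂ := by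
  rw [Submodule.finrank_eq_zero.1 h₁, Submodule.finrank_eq_zero.1 h₂]

theorem pow_card_injective (K L : Type*) [Field K] [Field L] [Finite L] [Algebra K L] :
    Function.Injective (Nat.card K ^ ·) := by
  have : Finite K := Finite.of_injective _ (algebraMap K L).injective
  exact Nat.pow_right_injective Finite.one_lt_card

theorem finrank_commonKernel_eq_of_nullities_eq {C₁ C₂ : Submodule L (L →ₗ[K] L)}
    (hk : finrank L C₁ = finrank L C₂) (h : nullities C₁ = nullities C₂) :
    finrank K (commonKernel C₁) = finrank K (commonKernel C₂) := by
  obtain h0 | h2 := Nat.eq_zero_or_eq_succ_pred (finrank L C₂)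
  · rw [eq_of_finrank_eq_zero (hk.trans h0) h0]
  generalize (finrank L C₂).pred = k at h2
  have e₁ := sum_card_pow_nullity C₁ (hk.trans h2)
  have e₂ := sum_card_pow_nullity C₂ h2
  rw [h] at e₁
  apply pow_card_injective K L
  have hQ : 1 < Nat.card L := Finite.one_lt_card
  have hlt : Nat.card L ^ k < Nat.card L ^ (k + 1) := Nat.pow_lt_pow_right hQ (Nat.lt_succ_self k)
  zify at e₁ e₂ hlt ⊢
  refine mul_right_cancel₀ (sub_pos.2 hlt).ne' ?_
  linear_combination e₂ - e₁

theorem finrank_commonKernel_eq_of_relNullities_eq {C₁ C₂ : Submodule L (L →ₗ[K] L)}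
    (hk : finrank L C₁ = finrank L C₂) (h1 : finrank L C₁ ≠ 1)
    (h : relNullities C₁ = relNullities C₂) :
    finrank K (commonKernel C₁) = finrank K (commonKernel C₂) := by
  obtain h0 | h2 := Nat.eq_zero_or_eq_succ_pred (finrank L C₂)
  · rw [eq_of_finrank_eq_zero (hk.trans h0) h0]
  have hsum (C : Submodule L (L →ₗ[K] L)) : ((nullities C).map (Nat.card K ^ ·)).sum =
      Nat.card L + ((relNullities C).map (Nat.card K ^ ·)).sum *
        Nat.card K ^ finrank K (commonKernel C) := by
    rw [nullities_eq_cons, Multiset.map_cons, Multiset.sum_cons, Multiset.map_map,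
      ← natCard_eq_pow_finrank, ← Multiset.sum_map_mul_right]
    simp_rw [Function.comp_def, pow_add]
  generalize (finrank L C₂).pred = k at h2
  have e₁ := sum_card_pow_nullity C₁ (hk.trans h2)
  have e₂ := sum_card_pow_nullity C₂ h2
  rw [hsum] at e₁ e₂
  rw [h] at e₁
  apply pow_card_injective K L
  have hQ : 1 < Nat.card L := Finite.one_lt_card
  have hlt : Nat.card L ^ 1 < Nat.card L ^ (k + 1) := Nat.pow_lt_pow_right hQ (by omega)
  rw [pow_one] at hlt
  dsimp only
  generalize Nat.card K ^ finrank K (commonKernel C₁) = x at *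
  generalize Nat.card K ^ finrank K (commonKernel C₂) = y at *
  generalize ((relNullities C₂).map (Nat.card K ^ ·)).sum = S at *
  zify at e₁ e₂ hlt ⊢
  -- The unknown y = q^d has a nonzero coefficient because the right side is positive, which uses k
  -- > 0, that is, dim C > 1.
  have hy : ((S : ℤ) + Nat.card L ^ k - Nat.card L ^ (k + 1)) * y =
      Nat.card L ^ (k + 1) - Nat.card L := by linear_combination e₂
  have hne : ((S : ℤ) + Nat.card L ^ k - Nat.card L ^ (k + 1)) ≠ 0 := fun h0 => by
    rw [h0, zero_mul] at hy
    omega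
  refine mul_left_cancel₀ hne ?_
  linear_combination e₁ - e₂

end CommonKernelDimension

/-! ### Conclusion -/

section Main

variable {K L : Type*} [Field K] [Fintype K] [Field L] [Finite L] [Algebra K L]

/-- The weight distribution with respect to hyperplanes determines that of the dual. -/
theorem hyperplaneWeightDistribution_dual_eq {C₁ C₂ : Submodule L (L →ₗ[K] L)}
    {Λ₁ : LinearSet K L (finrank L C₁)} {Λ₂ : LinearSet K L (finrank L C₂)}
    {M₁ : LinearSet K L (finrank L (dual C₁))} {M₂ : LinearSet K L (finrank L (dual C₂))}
    (h₁ : Λ₁ ∈ linearSets C₁) (h₂ : Λ₂ ∈ linearSets C₂)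
    (hM₁ : M₁ ∈ linearSets (dual C₁)) (hM₂ : M₂ ∈ linearSets (dual C₂))
    (hk : finrank L C₁ = finrank L C₂) (hrank : finrank L C₁ = 1 → Λ₁.rank = Λ₂.rank)
    (h : Λ₁.hyperplaneWeightDistribution = Λ₂.hyperplaneWeightDistribution) :
    M₁.hyperplaneWeightDistribution = M₂.hyperplaneWeightDistribution := by
  have hrel := relNullities_eq h₁ h₂ hk h
  have hd : finrank K (commonKernel C₁) = finrank K (commonKernel C₂) := by
    -- In dimension one all relative nullities are 0 whatever d is, so d must come from the rank.
    by_cases hk1 : finrank L C₁ = 1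
    · have r₁ := rank_add_finrank_commonKernel h₁
      have r₂ := rank_add_finrank_commonKernel h₂
      have := hrank hk1
      omega
    · exact finrank_commonKernel_eq_of_relNullities_eq hk hk1 hrel
  have hnull : nullities C₁ = nullities C₂ := by
    rw [nullities_eq_cons, nullities_eq_cons, hrel, hd]
  have hnull' := nullities_dual_eq hk hnull
  have hk' : finrank L (dual C₁) = finrank L (dual C₂) := by
    have := finrank_dual_add C₁
    have := finrank_dual_add C₂
    omega
  have hd' := finrank_commonKernel_eq_of_nullities_eq hk' hnull'
  refine hyperplaneWeightDistribution_eq hM₁ hM₂ ?_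
  rw [nullities_eq_cons, nullities_eq_cons, hd', Multiset.cons_inj_right] at hnull'
  exact Multiset.map_injective (add_left_injective _) hnull'

end Main

end LinSet

theorem mainTheorem4 (K L : Type*) [Field K] [Fintype K] [Field L] [Finite L] [Algebra K L] :
    (∀ C : Submodule L (L →ₗ[K] L), ∀ Λ ∈ LinSet.linearSets C, ∀ Λ' ∈ LinSet.linearSets C,
      Λ.hyperplaneWeightDistribution = Λ'.hyperplaneWeightDistribution) ∧
    ∀ k : ℕ, ∃ Φ : (Fin (Module.finrank K L) → ℕ) → (Fin (Module.finrank K L) → ℕ),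
      ∀ C : Submodule L (L →ₗ[K] L), Module.finrank L C = k →
        ∀ Λ ∈ LinSet.linearSets C, (k = 1 → Λ.rank = Module.finrank K L) →
          ∀ M ∈ LinSet.linearSets (LinSet.dual C),
            M.hyperplaneWeightDistribution = Φ Λ.hyperplaneWeightDistribution := by
  refine ⟨fun C Λ hΛ Λ' hΛ' => LinSet.hyperplaneWeightDistribution_eq hΛ hΛ' rfl, fun k => ?_⟩
  let R (v w : Fin (Module.finrank K L) → ℕ) : Prop :=
    ∃ C : Submodule L (L →ₗ[K] L), Module.finrank L C = k ∧
      ∃ Λ ∈ LinSet.linearSets C, (k = 1 → Λ.rank = Module.finrank K L) ∧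
        ∃ M ∈ LinSet.linearSets (LinSet.dual C),
          Λ.hyperplaneWeightDistribution = v ∧ M.hyperplaneWeightDistribution = w
  have hR : ∀ v, ∃ w, ∀ w', R v w' → w' = w := by
    intro v
    by_cases hv : ∃ w, R v w
    · obtain ⟨w, C₂, hk₂, Λ₂, h₂, hr₂, M₂, hM₂, e₂, rfl⟩ := hv
      refine ⟨M₂.hyperplaneWeightDistribution, ?_⟩
      rintro w' ⟨C₁, hk₁, Λ₁, h₁, hr₁, M₁, hM₁, e₁, rfl⟩
      exact LinSet.hyperplaneWeightDistribution_dual_eq h₁ h₂ hM₁ hM₂ (hk₁.trans hk₂.symm)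
        (fun h => (hr₁ (hk₁.symm.trans h)).trans (hr₂ (hk₁.symm.trans h)).symm) (e₁.trans e₂.symm)
    -- No admissible code realises v, so the value is arbitrary.
    · exact ⟨v, fun w' hw' => (hv ⟨w', hw'⟩).elim⟩
  choose Φ hΦ using hR
  exact ⟨Φ, fun C hk Λ hΛ hr M hM => hΦ _ _ ⟨C, hk, Λ, hΛ, hr, M, hM, rfl, rfl⟩⟩
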